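/- Work in classical first-order logic with equality over the language $L_{\mathrm{LA}}=\{0,s,p,+\}$ with $0$ a constant, $s,p$ unary and $+$ binary function symbols. Write $\overline{i}$ for the numeral $s^{i}(0)$, and for a term $t$ define $0\cdot t=0$, $(i+1)\cdot t=t+(i\cdot t)$. Let $B$ be the theory axiomatized by the universal closures of $$s(0)\neq 0,\quad p(0)=0,\quad p(s(x))=x,\quad x+0=x,\quad x+s(y)=s(x+y),$$ and let $\mathrm{B2}$ and $\mathrm{B3}$ be the universal closures of $x+y=y+x$ and $x+(y+z)=(x+y)+z$, respectively. An $\exists_1$ formula is a formula $\exists y_1\cdots\exists y_l\,\psi$ with $l\ge 0$ and $\psi$ quantifier-free. The parameter-free $\exists_1$ induction rule $R$ has the instances $$\frac{\gamma(0)\qquad \forall x\,(\gamma(x)\to\gamma(s(x)))}{\forall x\,\gamma(x)},$$ where $\gamma(x)$ is an $\exists_1$ formula of $L_{\mathrm{LA}}$ with no free variable other than $x$. For a theory (set of sentences) $T$ let $[T,R]$ be $T$ together with the conclusions of all instances of $R$ whose premises are all provable from $T$; let $[T,R]_0=T$, $[T,R]_{j+1}=[[T,R]_j,R]$, and $T+R=\bigcup_{j\ge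 0}[T,R]_j$. **Theorem.** Let $k,n,m\in\mathbb{N}$ with $0<n<m$. Then $$(B+\mathrm{B2}+\mathrm{B3})+R\;\not\vdash\; n\cdot x+\overline{(m-n)k}=m\cdot x\;\to\;x=\overline{k}.$$ -/

import Mathlib

namespace LinArith

open FirstOrder FirstOrder.Language

section Logic

universe u v

variable {L : FirstOrder.Language.{u, v}}

/-- `φ(t)`: the result of substituting the term `t` for the (only) loose bound variable of `φ`.
Variables of `t` cannot be captured, since bound variables are de Bruijn levels. -/
def inst (φ : L.BoundedFormula ℕ 1) (t : L.Term ℕ) : L.Formula ℕ :=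
  φ.toFormula.subst (Sum.elim Term.var fun _ => t)

/-- A sentence, seen as a formula over the variables `v₀, v₁, v₂, …`. -/
def ofSentence (σ : L.Sentence) : L.Formula ℕ :=
  Formula.relabel (Empty.elim : Empty → ℕ) σ

/-- Provability `T ⊢ φ` in classical first-order logic with equality, as a Hilbert calculus on
formulas with variables `v₀, v₁, v₂, …`. The primitive connectives are `⊥`, `→`, `∀`, `=`; the
other ones (`¬`, `∧`, `∨`, `↔`, `∃`) are the usual abbreviations. -/
inductive Provable (T : L.Theory) : L.Formula ℕ → Prop
  /-- the axioms of the theory -/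
  | ax {σ : L.Sentence} (h : σ ∈ T) : Provable T (ofSentence σ)
  /-- classical propositional logic -/
  | imp_k (φ ψ : L.Formula ℕ) : Provable T (φ.imp (ψ.imp φ))
  | imp_s (φ ψ χ : L.Formula ℕ) :
      Provable T ((φ.imp (ψ.imp χ)).imp ((φ.imp ψ).imp (φ.imp χ)))
  | dne (φ : L.Formula ℕ) : Provable T (φ.not.not.imp φ)
  | mp {φ ψ : L.Formula ℕ} (h₁ : Provable T (φ.imp ψ)) (h₂ : Provable T φ) : Provable T ψ
  /-- `∀ x φ(x) → φ(t)` -/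
  | all_elim (φ : L.BoundedFormula ℕ 1) (t : L.Term ℕ) : Provable T (φ.all.imp (inst φ t))
  /-- from `ψ → φ(x)` infer `ψ → ∀ x φ(x)`, where `x` is not free in `ψ` and `∀ x φ(x)` -/
  | gen (ψ : L.Formula ℕ) (φ : L.BoundedFormula ℕ 1) (x : ℕ)
      (hψ : x ∉ ψ.freeVarFinset) (hφ : x ∉ φ.freeVarFinset)
      (h : Provable T (ψ.imp (inst φ (Term.var x)))) : Provable T (ψ.imp φ.all)
  /-- equality: reflexivity and the scheme `t₁ = t₂ → (φ(t₁) → φ(t₂))` -/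
  | eq_refl (t : L.Term ℕ) : Provable T (t.equal t)
  | eq_subst (φ : L.BoundedFormula ℕ 1) (t₁ t₂ : L.Term ℕ) :
      Provable T ((t₁.equal t₂).imp ((inst φ t₁).imp (inst φ t₂)))

/-- The universal closure of a formula with free variables among `x₀, …, xₙ₋₁`. -/
def univClosure {n : ℕ} (φ : L.Formula (Fin n)) : L.Sentence :=
  BoundedFormula.alls (n := n) (BoundedFormula.relabel (k := 0) (Sum.inr : Fin n → Empty ⊕ Fin n) φ)

/-- An inference rule: a set of instances `Γ / γ₀`, where `Γ` is a finite collection of sentences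
(listed as `γ₁, …, γₙ`) and `γ₀` is a sentence. -/
abbrev InferenceRule (L : FirstOrder.Language.{u, v}) := Set (List L.Sentence × L.Sentence)

/-- `[T, R]`: the theory of unnested applications of the rule `R` over `T`. -/
def unnested (T : L.Theory) (R : InferenceRule L) : L.Theory :=
  T ∪ {φ | ∃ Γ : List L.Sentence, (Γ, φ) ∈ R ∧ ∀ γ ∈ Γ, Provable T (ofSentence γ)}

/-- `[T, R]ₙ`: `[T, R]₀ = T` and `[T, R]ₙ₊₁ = [[T, R]ₙ, R]`. -/
def nested (T : L.Theory) (R : InferenceRule L) : ℕ → L.Theory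
  | 0 => T
  | n + 1 => unnested (nested T R n) R

/-- `T + R = ⋃ₙ [T, R]ₙ`: the theory of arbitrarily nested applications of `R` over `T`. -/
def addRule (T : L.Theory) (R : InferenceRule L) : L.Theory :=
  ⋃ n : ℕ, nested T R n

end Logic

/-- The function symbols `0/0`, `s/1`, `p/1`, `+/2`. -/
inductive LAFunc : ℕ → Type
  | zero : LAFunc 0
  | succ : LAFunc 1
  | pred : LAFunc 1
  | add : LAFunc 2

/-- The language `{0, s, p, +}` of linear arithmetic; the only predicate symbol is equality. -/
def LA : FirstOrder.Language.{0, 0} where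
  Functions := LAFunc
  Relations := fun _ => Empty

section Terms

variable {α : Type}

/-- The term `0`. -/
def zero : LA.Term α := Constants.term (L := LA) LAFunc.zero

/-- The term `s(t)`. -/
def succ (t : LA.Term α) : LA.Term α := Functions.apply₁ (L := LA) LAFunc.succ t

/-- The term `p(t)`. -/
def pred (t : LA.Term α) : LA.Term α := Functions.apply₁ (L := LA) LAFunc.pred t

/-- The term `t + u`. -/
def add (t u : LA.Term α) : LA.Term α := Functions.apply₂ (L := LA) LAFunc.add t u

/-- The numeral `sⁿ(0)`. -/
def numeral : ℕ → LA.Term α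
  | 0 => zero
  | n + 1 => succ (numeral n)

/-- The term `n · t`, with `0 · t = 0` and `(i + 1) · t = t + (i · t)`. -/
def mulConst : ℕ → LA.Term α → LA.Term α
  | 0, _ => zero
  | i + 1, t => add t (mulConst i t)

end Terms

/-- The variable `xᵢ`, among `x₀, …, xₙ₋₁`. -/
abbrev xvar {n : ℕ} (i : Fin n) : LA.Term (Fin n) := Term.var i

/-- `s(0) ≠ 0` -/
def axiomA1 : LA.Sentence :=
  univClosure (n := 0) ((succ zero).equal zero).not

/-- `p(0) = 0` -/
def axiomA2 : LA.Sentence :=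
  univClosure (n := 0) ((pred zero).equal zero)

/-- `p(s(x)) = x` -/
def axiomA3 : LA.Sentence :=
  univClosure (n := 1) ((pred (succ (xvar 0))).equal (xvar 0))

/-- `x + 0 = x` -/
def axiomA4 : LA.Sentence :=
  univClosure (n := 1) ((add (xvar 0) zero).equal (xvar 0))

/-- `x + s(y) = s(x + y)` -/
def axiomA5 : LA.Sentence :=
  univClosure (n := 2) ((add (xvar 0) (succ (xvar 1))).equal (succ (add (xvar 0) (xvar 1))))

/-- The base theory `B` of linear arithmetic. -/
def theoryB : LA.Theory := {axiomA1, axiomA2, axiomA3, axiomA4, axiomA5}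

/-- `x + y = y + x` -/
def axiomB2 : LA.Sentence :=
  univClosure (n := 2) ((add (xvar 0) (xvar 1)).equal (add (xvar 1) (xvar 0)))

/-- `x + (y + z) = (x + y) + z` -/
def axiomB3 : LA.Sentence :=
  univClosure (n := 3)
    ((add (xvar 0) (add (xvar 1) (xvar 2))).equal (add (add (xvar 0) (xvar 1)) (xvar 2)))

/-- The `∃₁` formulas in (at most) one free variable: a possibly empty block of existential
quantifiers in front of a quantifier-free formula. -/
def existsOne : Set (LA.Formula (Fin 1)) := {γ | γ.IsExistential}

/-- The parameter-free induction rule for a set of formulas in one free variable: from `γ(0)` and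
`∀ x (γ(x) → γ(s(x)))` infer `∀ x γ(x)`. -/
def paramFreeInd (G : Set (LA.Formula (Fin 1))) : InferenceRule LA :=
  {r | ∃ γ ∈ G, r =
    ([γ.subst fun _ => (zero : LA.Term Empty),
      univClosure (γ.imp (γ.subst fun _ => succ (xvar 0)))],
     univClosure γ)}

/-- The formula `E_{k,n,m}`: `n · x + (m - n)k = m · x → x = k` (with numerals for `(m - n)k` and
`k`), where `x` is the variable `v₀`. It is meant for `n < m`. -/
def formulaE (k n m : ℕ) : LA.Formula ℕ :=
  ((add (mulConst n (Term.var 0)) (numeral ((m - n) * k))).equal (mulConst m (Term.var 0))).imp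
    ((Term.var 0 : LA.Term ℕ).equal (numeral k))

end LinArith

/-! The countermodel is `Ext`, the naturals followed by one copy of ℤ. The point `nonstd k`
satisfies `n · x + (m - n)k = m · x`, but differs from the standard numeral `k`. It remains to see
that `Ext` respects the rule. By soundness, ℕ satisfies every conclusion `∀ x γ(x)`, and the step
premise propagates γ upwards along the ℤ-part, so γ is only needed at arbitrarily low nonstandard
points (`exists_realize_nonstd_le`). Pick witnesses for γ(r) in ℕ for every r. Dickson's lemma and
an ultrafilter yield two comparable solution tuples that agree on which equations hold and which
arguments of `p` vanish. The line through the two tuples, followed far in the negative direction, is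
again a solution, now in `Ext`: its constant coordinates stay standard, and the others, among them
x, become nonstandard. -/

namespace LinArith

open FirstOrder FirstOrder.Language Filter

/-! ### Soundness of the calculus -/

section Soundness

universe u v w

variable {L : FirstOrder.Language.{u, v}} {M : Type w} [L.Structure M]

theorem realize_inst (φ : L.BoundedFormula ℕ 1) (t : L.Term ℕ) (v : ℕ → M) :
    (inst φ t).Realize v ↔ φ.Realize v fun _ => t.realize v := by
  unfold inst
  rw [Formula.Realize, BoundedFormula.realize_subst, ← Formula.Realize,
    BoundedFormula.realize_toFormula]
  rfl

theorem realize_ofSentence (σ : L.Sentence) (v : ℕ → M) :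
    (ofSentence σ).Realize v ↔ M ⊨ σ := by
  unfold ofSentence
  rw [Formula.realize_relabel, Sentence.Realize, Subsingleton.elim (v ∘ Empty.elim) default]

theorem realize_univClosure {n : ℕ} (φ : L.Formula (Fin n)) :
    M ⊨ univClosure φ ↔ ∀ x : Fin n → M, φ.Realize x := by
  unfold univClosure
  rw [Sentence.Realize, BoundedFormula.realize_alls]
  exact forall_congr' fun x => Formula.realize_relabel_sumInr φ

theorem realize_congr_of_eqOn_freeVarFinset {α : Type*} [DecidableEq α] {n : ℕ}
    (φ : L.BoundedFormula α n) {v v' : α → M} (xs : Fin n → M)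
    (h : ∀ a ∈ φ.freeVarFinset, v a = v' a) : φ.Realize v xs ↔ φ.Realize v' xs := by
  have key {n : ℕ} (t : L.Term (α ⊕ Fin n)) (xs : Fin n → M)
      (ht : ∀ a ∈ t.varFinsetLeft, v a = v' a) :
      t.realize (Sum.elim v xs) = t.realize (Sum.elim v' xs) := by
    induction t with
    | var a =>
      rcases a with a | i
      · exact ht a (by simp [Term.varFinsetLeft])
      · rfl
    | func f ts ih =>
      simp only [Term.realize]
      congr 1
      funext i
      exact ih i fun a ha => ht a (by simpa [Term.varFinsetLeft] using ⟨i, ha⟩)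
  induction φ with
  | falsum => rfl
  | equal t₁ t₂ =>
    simp only [BoundedFormula.freeVarFinset, Finset.mem_union] at h
    simp only [BoundedFormula.Realize]
    rw [key t₁ xs fun a ha => h a (.inl ha), key t₂ xs fun a ha => h a (.inr ha)]
  | rel R ts =>
    simp only [BoundedFormula.freeVarFinset, Finset.mem_biUnion, Finset.mem_univ, true_and] at h
    simp only [BoundedFormula.Realize]
    rw [funext fun i => key (ts i) xs fun a ha => h a ⟨i, ha⟩]
  | imp φ ψ ih₁ ih₂ =>
    simp only [BoundedFormula.freeVarFinset, Finset.mem_union] at h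
    simp only [BoundedFormula.Realize]
    exact imp_congr (ih₁ xs fun a ha => h a (.inl ha)) (ih₂ xs fun a ha => h a (.inr ha))
  | all φ ih =>
    simp only [BoundedFormula.Realize]
    exact forall_congr' fun x => ih _ h

theorem Provable.realize {T : L.Theory} (hT : M ⊨ T) {φ : L.Formula ℕ} (h : Provable T φ) :
    ∀ v : ℕ → M, φ.Realize v := by
  induction h with
  | ax hσ => exact fun v => (realize_ofSentence _ v).2 (hT.realize_of_mem _ hσ)
  | imp_k φ ψ =>
    intro v
    simp only [Formula.realize_imp]
    tauto
  | imp_s φ ψ χ =>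
    intro v
    simp only [Formula.realize_imp]
    tauto
  | dne φ =>
    intro v
    simp only [Formula.realize_imp, Formula.realize_not]
    tauto
  | mp _ _ ih₁ ih₂ => exact fun v => Formula.realize_imp.1 (ih₁ v) (ih₂ v)
  | all_elim φ t =>
    intro v
    rw [Formula.realize_imp, realize_inst]
    intro h
    have := BoundedFormula.realize_all.1 h (t.realize v)
    convert this using 1
    exact funext fun i => by rw [show i = Fin.last 0 from Fin.eq_zero i, Fin.snoc_last]
  | gen ψ φ x hψ hφ _ ih =>
    intro v
    rw [Formula.realize_imp]
    intro h
    refine BoundedFormula.realize_all.2 fun a => ?_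
    have hne : ∀ {s : Finset ℕ}, x ∉ s → ∀ b ∈ s, v b = Function.update v x a b :=
      fun hs b hb => (Function.update_of_ne (ne_of_mem_of_not_mem hb hs) a v).symm
    have h' := ih (Function.update v x a)
    rw [Formula.realize_imp, realize_inst] at h'
    have h₂ := (realize_congr_of_eqOn_freeVarFinset φ _ (hne hφ)).2
      (h' ((realize_congr_of_eqOn_freeVarFinset ψ _ (hne hψ)).1 h))
    convert h₂ using 1
    exact funext fun i => by
      rw [show i = Fin.last 0 from Fin.eq_zero i, Fin.snoc_last, Term.realize_var,
        Function.update_self]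
  | eq_refl t => exact fun v => Formula.realize_equal.2 rfl
  | eq_subst φ t₁ t₂ =>
    intro v
    simp only [Formula.realize_imp, Formula.realize_equal, realize_inst]
    intro e
    rw [e]
    exact id

end Soundness

/-! ### The two models, and lines evaluated in `Ext` -/

/-- The standard structure on `ℕ`. -/
instance natStructure : LA.Structure ℕ where
  funMap {n} (f : LAFunc n) :=
    match n, f with
    | _, .zero => fun _ => 0
    | _, .succ => fun x => x 0 + 1
    | _, .pred => fun x => x 0 - 1
    | _, .add => fun x => x 0 + x 1
  RelMap r := r.elim

/-- The natural numbers followed by one copy of the integers. -/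
inductive Ext : Type
  | std (n : ℕ)
  | nonstd (z : ℤ)

namespace Ext

/-- The integer underlying an element of either part. -/
def val : Ext → ℤ
  | std n => n
  | nonstd z => z

/-- The successor. -/
def succ : Ext → Ext
  | std n => std (n + 1)
  | nonstd z => nonstd (z + 1)

/-- The predecessor, truncated on the standard part. -/
def pred : Ext → Ext
  | std n => std (n - 1)
  | nonstd z => nonstd (z - 1)

/-- The sum, which is standard only for standard summands. -/
def add : Ext → Ext → Ext
  | std m, std n => std (m + n)
  | x, y => nonstd (x.val + y.val)

theorem add_comm (x y : Ext) : x.add y = y.add x := by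
  cases x <;> cases y <;> simp [add, val, Int.add_comm, Nat.add_comm]

theorem add_assoc (x y z : Ext) : x.add (y.add z) = (x.add y).add z := by
  cases x <;> cases y <;> cases z <;> simp [add, val, Int.add_assoc, Nat.add_assoc]

instance : LA.Structure Ext where
  funMap {n} (f : LAFunc n) :=
    match n, f with
    | _, .zero => fun _ => std 0
    | _, .succ => fun x => (x 0).succ
    | _, .pred => fun x => (x 0).pred
    | _, .add => fun x => (x 0).add (x 1)
  RelMap r := r.elim

/-- The point with parameter `-t` on the line through `a` (parameter `0`) and `b` (parameter `1`);
it is nonstandard unless the line is constant. -/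
def ray (t a b : ℕ) : Ext :=
  if a = b then std a else nonstd (a - t * (b - a))

theorem succ_ray (t a b : ℕ) : (ray t a b).succ = ray t (a + 1) (b + 1) := by
  by_cases h : a = b
  · simp [ray, h, succ]
  · simp only [ray, h, if_false, succ, Nat.add_right_cancel_iff]
    congr 1
    push_cast
    ring

/-- Truncation at 0 is not affine, so the endpoints must both be cut off or both be shifted. -/
theorem pred_ray {t a b : ℕ} (h₀ : a = 0 ↔ b = 0) :
    (ray t a b).pred = ray t (a - 1) (b - 1) := by
  rcases a with _ | a
  · simp [ray, h₀.1 rfl, pred]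
  · obtain ⟨b, rfl⟩ : ∃ c, b = c + 1 := Nat.exists_eq_succ_of_ne_zero (by simp [← h₀])
    rw [← succ_ray, Nat.add_sub_cancel, Nat.add_sub_cancel]
    cases ray t a b <;> simp [succ, pred]

/-- The inequalities keep opposite slopes from cancelling: a sum of two non-constant lines could
otherwise be constant, hence standard on the right but nonstandard on the left. -/
theorem ray_add {t a b a' b' : ℕ} (h : a ≤ b) (h' : a' ≤ b') :
    (ray t a b).add (ray t a' b') = ray t (a + a') (b + b') := by
  by_cases e : a = b
  · by_cases e' : a' = b'
    · simp [ray, e, e', add]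
    · have : ¬ a + a' = b + b' := by omega
      simp only [ray, e, e', if_true, if_false, add, val, Nat.add_left_cancel_iff]
      congr 1
      push_cast
      ring
  · have : ¬ a + a' = b + b' := by omega
    by_cases e' : a' = b'
    · simp only [ray, e, e', if_true, if_false, add, val, Nat.add_right_cancel_iff]
      congr 1
      push_cast
      ring
    · simp only [ray, e, e', this, if_false, add, val]
      congr 1
      push_cast
      ring

theorem eventually_ray_ne {a b a' b' : ℕ} (h : a ≠ a') :
    ∀ᶠ t in atTop, ray t a b ≠ ray t a' b' := by
  filter_upwards [eventually_gt_atTop (a + a')] with t ht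
  unfold ray
  split_ifs with e e'
  · simpa using h
  · simp
  · simp
  · simp only [ne_eq, nonstd.injEq]
    intro heq
    -- Equality of the points makes t divide a - a', whose absolute value is below t.
    have key : (a : ℤ) - a' = t * (((b : ℤ) - a) - (b' - a')) := by linarith
    have hdvd : (t : ℤ) ∣ (a : ℤ) - a' := ⟨_, key⟩
    have := Int.eq_zero_of_abs_lt_dvd hdvd (by rw [abs_lt]; constructor <;> omega)
    omega

end Ext

/-! ### Transfer of existential formulas from ℕ to low points of `Ext` -/

section Transfer

variable {β : Type}

theorem realize_zero {M : Type*} [LA.Structure M] (v : β → M) :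
    (zero : LA.Term β).realize v = Structure.funMap (L := LA) LAFunc.zero ![] := by
  simp only [zero, Constants.term, Term.realize]
  congr 1
  exact Subsingleton.elim _ _

/-- Ensures that term values along a monotone sequence give lines of nonnegative slope, as
`Ext.ray_add` requires. -/
theorem realize_nat_mono (τ : LA.Term β) {v v' : β → ℕ} (h : v ≤ v') :
    τ.realize v ≤ τ.realize v' := by
  induction τ with
  | var a => exact h a
  | @func n f ts ih =>
    rcases f with _ | _ | _ | _
    · exact le_rfl
    · exact Nat.succ_le_succ (ih 0)
    · exact Nat.sub_le_sub_right (ih 0) 1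
    · exact Nat.add_le_add (ih 0) (ih 1)

theorem exists_mem_forall_iff (U : Ultrafilter ℕ) (p : ℕ → Prop) :
    ∃ A ∈ U, ∀ r ∈ A, ∀ r' ∈ A, p r ↔ p r' := by
  rcases U.em p with h | h
  · exact ⟨_, h, fun r hr r' hr' => iff_of_true hr hr'⟩
  · exact ⟨_, h, fun r hr r' hr' => iff_of_false hr hr'⟩

/-- Only `p` needs a choice of indices: the ultrafilter decides whether its argument vanishes, and
`Ext.pred_ray` then applies. -/
theorem exists_mem_realize_ray (U : Ultrafilter ℕ) {f : ℕ → β → ℕ} (hf : Monotone f)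
    (τ : LA.Term β) :
    ∃ A ∈ U, ∀ r ∈ A, ∀ r' ∈ A, r ≤ r' → ∀ t,
      τ.realize (fun j => Ext.ray t (f r j) (f r' j)) =
        Ext.ray t (τ.realize (f r)) (τ.realize (f r')) := by
  induction τ with
  | var a => exact ⟨_, univ_mem, fun _ _ _ _ _ _ => rfl⟩
  | @func n g ts ih =>
    rcases g with _ | _ | _ | _
    · exact ⟨_, univ_mem, fun _ _ _ _ _ _ => (if_pos rfl).symm⟩
    · obtain ⟨A, hA, h⟩ := ih 0
      refine ⟨A, hA, fun r hr r' hr' hrr t => ?_⟩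
      exact (congrArg Ext.succ (h r hr r' hr' hrr t)).trans (Ext.succ_ray _ _ _)
    · obtain ⟨A, hA, h⟩ := ih 0
      obtain ⟨A', hA', h'⟩ :=
        exists_mem_forall_iff U fun r => (ts 0).realize (f r) = 0
      refine ⟨A ∩ A', inter_mem hA hA', fun r hr r' hr' hrr t => ?_⟩
      exact (congrArg Ext.pred (h r hr.1 r' hr'.1 hrr t)).trans
        (Ext.pred_ray (h' r hr.2 r' hr'.2))
    · obtain ⟨A, hA, h⟩ := ih 0
      obtain ⟨A', hA', h'⟩ := ih 1
      refine ⟨A ∩ A', inter_mem hA hA', fun r hr r' hr' hrr t => ?_⟩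
      exact (congrArg₂ Ext.add (h r hr.1 r' hr'.1 hrr t) (h' r hr.2 r' hr'.2 hrr t)).trans
        (Ext.ray_add (realize_nat_mono _ (hf hrr)) (realize_nat_mono _ (hf hrr)))

/-- The ultrafilter also decides each equation. One that holds at both r and r' holds along the
whole line; one that fails at r fails on the line for large t. -/
theorem exists_mem_realize_iff {α : Type} {n : ℕ} (U : Ultrafilter ℕ) {f : ℕ → α ⊕ Fin n → ℕ}
    (hf : Monotone f) {φ : LA.BoundedFormula α n} (hφ : φ.IsQF) :
    ∃ A ∈ U, ∀ r ∈ A, ∀ r' ∈ A, r ≤ r' → ∀ᶠ t in atTop,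
      (φ.Realize (fun a => Ext.ray t (f r (.inl a)) (f r' (.inl a)))
          (fun i => Ext.ray t (f r (.inr i)) (f r' (.inr i))) ↔
        φ.Realize (f r ∘ .inl) (f r ∘ .inr)) := by
  induction hφ with
  | falsum => exact ⟨_, univ_mem, fun _ _ _ _ _ => .of_forall fun _ => Iff.rfl⟩
  | of_isAtomic h =>
    rcases h with ⟨τ₁, τ₂⟩ | ⟨R, _⟩
    · obtain ⟨A₁, hA₁, h₁⟩ := exists_mem_realize_ray U hf τ₁
      obtain ⟨A₂, hA₂, h₂⟩ := exists_mem_realize_ray U hf τ₂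
      obtain ⟨A, hA, h⟩ :=
        exists_mem_forall_iff U fun r => τ₁.realize (f r) = τ₂.realize (f r)
      refine ⟨A₁ ∩ A₂ ∩ A, inter_mem (inter_mem hA₁ hA₂) hA, fun r hr r' hr' hrr => ?_⟩
      have e (t : ℕ) : (Sum.elim (fun a => Ext.ray t (f r (.inl a)) (f r' (.inl a)))
          (fun i => Ext.ray t (f r (.inr i)) (f r' (.inr i)))) =
          fun j => Ext.ray t (f r j) (f r' j) := by
        funext j
        cases j <;> rfl
      simp only [BoundedFormula.realize_bdEqual, e, Sum.elim_comp_inl_inr,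
        h₁ r hr.1.1 r' hr'.1.1 hrr, h₂ r hr.1.2 r' hr'.1.2 hrr]
      by_cases heq : τ₁.realize (f r) = τ₂.realize (f r)
      · have heq' := (h r hr.2 r' hr'.2).1 heq
        exact .of_forall fun t => by simp only [heq, heq']
      · exact (Ext.eventually_ray_ne heq).mono fun t ht => iff_of_false ht heq
    · exact R.elim
  | imp _ _ ih₁ ih₂ =>
    obtain ⟨A₁, hA₁, h₁⟩ := ih₁
    obtain ⟨A₂, hA₂, h₂⟩ := ih₂
    refine ⟨A₁ ∩ A₂, inter_mem hA₁ hA₂, fun r hr r' hr' hrr => ?_⟩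
    filter_upwards [h₁ r hr.1 r' hr'.1 hrr, h₂ r hr.2 r' hr'.2 hrr] with t e₁ e₂
    rw [BoundedFormula.realize_imp, BoundedFormula.realize_imp, e₁, e₂]

/-- The tuples `xs r` collect the witnesses of the quantifiers already stripped; the matrix is
reached once all of them have been chosen. -/
theorem exists_realize_nonstd_le {n : ℕ} {φ : LA.BoundedFormula (Fin 1) n} (hφ : φ.IsExistential)
    (xs : ℕ → Fin n → ℕ) (h : ∀ r, φ.Realize (fun _ => r) (xs r)) (N : ℤ) :
    ∃ z ≤ N, ∃ ys : Fin n → Ext, φ.Realize (fun _ => Ext.nonstd z) ys := by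
  induction hφ with
  | @of_isQF n φ hφ =>
    -- Dickson's lemma, applied to r together with its witnesses.
    obtain ⟨g, hg⟩ := (wellQuasiOrdered_le (α := Fin 1 ⊕ Fin n → ℕ)).exists_monotone_subseq
      fun r => Sum.elim (fun _ => r) (xs r)
    obtain ⟨A, hA, hA'⟩ := exists_mem_realize_iff (hyperfilter ℕ)
      (f := fun r => Sum.elim (fun _ => g r) (xs (g r))) (fun a b hab => hg a b hab) hφ
    obtain ⟨r, hr⟩ := (hyperfilter ℕ).nonempty_of_mem hA
    -- The ultrafilter is nonprincipal, so its sets contain arbitrarily large indices.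
    obtain ⟨r', hr', hlt⟩ := (hyperfilter ℕ).nonempty_of_mem
      (inter_mem hA (Nat.hyperfilter_le_atTop (Ioi_mem_atTop r)))
    have hgr : g r < g r' := g.strictMono hlt
    -- The x-coordinate has slope at least 1, so this bound on t brings it below N.
    obtain ⟨t, ht, htN⟩ := ((hA' r hr r' hr' (le_of_lt hlt)).and
      (eventually_ge_atTop ((g r : ℤ) - N).toNat)).exists
    have hreal := ht.2 (h (g r))
    simp only [Sum.elim_inl, Ext.ray, hgr.ne, if_false] at hreal
    refine ⟨_, ?_, _, hreal⟩
    have h₁ : (g r : ℤ) - N ≤ t := Int.toNat_le.1 htN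
    have h₂ : (t : ℤ) * 1 ≤ t * ((g r' : ℤ) - g r) :=
      mul_le_mul_of_nonneg_left (by omega) (by omega)
    omega
  | ex _ ih =>
    simp only [BoundedFormula.realize_ex] at h
    choose y hy using h
    obtain ⟨z, hz, ys, hys⟩ := ih _ hy
    refine ⟨z, hz, Fin.init ys, BoundedFormula.realize_ex.2 ⟨ys (Fin.last _), ?_⟩⟩
    rwa [Fin.snoc_init_self]

end Transfer

/-! ### The models satisfy the base theory and the induction rule -/

theorem models_univClosure_of_induction {γ : LA.Formula (Fin 1)} (hγ : γ.IsExistential)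
    (hnat : ∀ x : Fin 1 → ℕ, γ.Realize x) (h₀ : γ.Realize fun _ => Ext.std 0)
    (hs : ∀ x : Ext, (γ.Realize fun _ => x) → γ.Realize fun _ => x.succ) :
    Ext ⊨ univClosure γ := by
  rw [realize_univClosure]
  suffices ∀ x : Ext, γ.Realize fun _ => x by
    intro x
    convert this (x 0) using 1
    exact funext fun i => by rw [Subsingleton.elim i 0]
  rintro (n | z)
  · induction n with
    | zero => exact h₀
    | succ n ih => exact hs _ ih
  · obtain ⟨z₀, hz₀, ys, hys⟩ := exists_realize_nonstd_le hγ (fun _ => default)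
      (fun r => (Formula.boundedFormula_realize_eq_realize γ _ _).2 (hnat fun _ => r)) z
    rw [Formula.boundedFormula_realize_eq_realize] at hys
    induction z, hz₀ using Int.leInduction with
    | base => exact hys
    | succ z _ ih => exact hs _ ih

theorem nat_models_base : ℕ ⊨ theoryB ∪ {axiomB2, axiomB3} := by
  refine ⟨fun σ hσ => ?_⟩
  rcases hσ with (rfl | rfl | rfl | rfl | rfl) | (rfl | rfl)
  all_goals
    refine (realize_univClosure _).2 fun x => ?_
    simp only [Formula.realize_not, Formula.realize_equal]
  · exact Nat.succ_ne_zero 0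
  · rfl
  · rfl
  · rfl
  · rfl
  · exact Nat.add_comm (x 0) (x 1)
  · exact (Nat.add_assoc (x 0) (x 1) (x 2)).symm

theorem ext_models_base : Ext ⊨ theoryB ∪ {axiomB2, axiomB3} := by
  refine ⟨fun σ hσ => ?_⟩
  rcases hσ with (rfl | rfl | rfl | rfl | rfl) | (rfl | rfl)
  all_goals
    refine (realize_univClosure _).2 fun x => ?_
    simp only [Formula.realize_not, Formula.realize_equal]
  · exact fun h => Nat.succ_ne_zero 0 (Ext.std.inj h)
  · rfl
  · change (x 0).succ.pred = x 0
    cases x 0 <;> simp [Ext.succ, Ext.pred]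
  · change (x 0).add (.std 0) = x 0
    cases x 0 <;> simp [Ext.add, Ext.val]
  · change (x 0).add (x 1).succ = ((x 0).add (x 1)).succ
    cases x 0 <;> cases x 1 <;> simp [Ext.add, Ext.val, Ext.succ] <;> omega
  · exact Ext.add_comm (x 0) (x 1)
  · exact Ext.add_assoc (x 0) (x 1) (x 2)

theorem models_of_provable {L : FirstOrder.Language} {M : Type*} [L.Structure M] [Nonempty M]
    {T : L.Theory} (hT : M ⊨ T) {σ : L.Sentence} (h : Provable T (ofSentence σ)) : M ⊨ σ :=
  (realize_ofSentence σ fun _ => Classical.arbitrary M).1 (h.realize hT _)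

theorem realize_subst_zero {M : Type*} [LA.Structure M] (γ : LA.Formula (Fin 1)) :
    M ⊨ (γ.subst fun _ => (zero : LA.Term Empty) : LA.Sentence) ↔
      γ.Realize fun _ => (Structure.funMap (L := LA) LAFunc.zero ![] : M) := by
  rw [Sentence.Realize, Formula.Realize, BoundedFormula.realize_subst, ← Formula.Realize]
  simp only [realize_zero]

theorem realize_step {M : Type*} [LA.Structure M] (γ : LA.Formula (Fin 1)) :
    M ⊨ univClosure (γ.imp (γ.subst fun _ => succ (xvar 0))) ↔
      ∀ x : M, (γ.Realize fun _ => x) →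
        γ.Realize fun _ => Structure.funMap (L := LA) LAFunc.succ ![x] := by
  rw [realize_univClosure]
  have e (x : Fin 1 → M) : Formula.Realize (γ.subst fun _ => succ (xvar (0 : Fin 1))) x ↔
      γ.Realize fun _ => Structure.funMap (L := LA) LAFunc.succ ![x 0] := by
    have hx : (succ (xvar (0 : Fin 1))).realize x =
        Structure.funMap (L := LA) LAFunc.succ ![x 0] :=
      Term.realize_functions_apply₁ (L := LA)
    rw [Formula.Realize, BoundedFormula.realize_subst, ← Formula.Realize, hx]
  simp only [Formula.realize_imp, e]
  refine ⟨fun h x => h fun _ => x, fun h x => ?_⟩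
  have := h (x 0)
  rwa [show (fun _ => x 0) = x from funext fun i => by rw [Subsingleton.elim i 0] ] at this

theorem nat_models_univClosure_of_induction {γ : LA.Formula (Fin 1)}
    (h₀ : γ.Realize fun _ => 0) (hs : ∀ x : ℕ, (γ.Realize fun _ => x) → γ.Realize fun _ => x + 1)
    (x : Fin 1 → ℕ) : γ.Realize x := by
  rw [show x = fun _ => x 0 from funext fun i => by rw [Subsingleton.elim i 0] ]
  induction x 0 with
  | zero => exact h₀
  | succ n ih => exact hs n ih

instance : Nonempty Ext := ⟨.std 0⟩

/-- Both models are carried along together, since the conclusion for `Ext` uses its truth in ℕ. -/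
theorem models_nested (j : ℕ) :
    ℕ ⊨ nested (theoryB ∪ {axiomB2, axiomB3}) (paramFreeInd existsOne) j ∧
      Ext ⊨ nested (theoryB ∪ {axiomB2, axiomB3}) (paramFreeInd existsOne) j := by
  induction j with
  | zero => exact ⟨nat_models_base, ext_models_base⟩
  | succ j ih =>
    obtain ⟨ihN, ihE⟩ := ih
    have key : ∀ σ ∈ nested (theoryB ∪ {axiomB2, axiomB3}) (paramFreeInd existsOne) (j + 1),
        ℕ ⊨ σ ∧ Ext ⊨ σ := by
      rintro σ (hσ | ⟨Γ, ⟨γ, hγ, heq⟩, hΓ⟩)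
      · exact ⟨ihN.realize_of_mem σ hσ, ihE.realize_of_mem σ hσ⟩
      · obtain ⟨rfl, rfl⟩ := Prod.mk.inj heq
        have p₀ := hΓ _ (List.mem_cons_self ..)
        have p₁ := hΓ _ (List.mem_cons_of_mem _ (List.mem_cons_self ..))
        have hnat : ∀ x : Fin 1 → ℕ, γ.Realize x := nat_models_univClosure_of_induction
          ((realize_subst_zero γ).1 (models_of_provable ihN p₀))
          ((realize_step γ).1 (models_of_provable ihN p₁))
        exact ⟨(realize_univClosure γ).2 hnat, models_univClosure_of_induction hγ hnat
          ((realize_subst_zero γ).1 (models_of_provable ihE p₀))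
          ((realize_step γ).1 (models_of_provable ihE p₁))⟩
    exact ⟨⟨fun σ hσ => (key σ hσ).1⟩, ⟨fun σ hσ => (key σ hσ).2⟩⟩

theorem ext_models_addRule :
    Ext ⊨ addRule (theoryB ∪ {axiomB2, axiomB3}) (paramFreeInd existsOne) := by
  refine ⟨fun σ hσ => ?_⟩
  obtain ⟨j, hj⟩ := Set.mem_iUnion.1 hσ
  exact (models_nested j).2.realize_of_mem σ hj

theorem realize_ext_numeral {β : Type} (v : β → Ext) (i : ℕ) :
    (numeral i : LA.Term β).realize v = .std i := by
  induction i with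
  | zero => rfl
  | succ i ih => exact congrArg Ext.succ ih

/-- The multiplier is positive because `0 · t` is standard. -/
theorem realize_ext_mulConst {β : Type} (v : β → Ext) {t : LA.Term β} {z : ℤ}
    (ht : t.realize v = .nonstd z) (i : ℕ) :
    (mulConst (i + 1) t).realize v = .nonstd ((i + 1) * z) := by
  induction i with
  | zero =>
    refine (congrArg (Ext.add · (.std 0)) ht).trans ?_
    simp [Ext.add, Ext.val]
  | succ i ih =>
    refine (congrArg₂ Ext.add ht ih).trans ?_
    simp only [Ext.add, Ext.val]
    congr 1
    push_cast
    ring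

end LinArith

/-! ### The counterexample -/

theorem mainTheorem2 (k n m : ℕ) (hn : 0 < n) (hnm : n < m) :
    ¬ LinArith.Provable
      (LinArith.addRule (LinArith.theoryB ∪ {LinArith.axiomB2, LinArith.axiomB3})
        (LinArith.paramFreeInd LinArith.existsOne))
      (LinArith.formulaE k n m) := by
  intro h
  have hE := h.realize LinArith.ext_models_addRule fun _ => .nonstd k
  rw [LinArith.formulaE, FirstOrder.Language.Formula.realize_imp,
    FirstOrder.Language.Formula.realize_equal, FirstOrder.Language.Formula.realize_equal,
    LinArith.realize_ext_numeral] at hE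
  -- The conclusion would equate a nonstandard point with a standard one, so only the premise is
  -- left to verify.
  refine LinArith.Ext.noConfusion (hE ?_)
  obtain ⟨n, rfl⟩ := Nat.exists_eq_succ_of_ne_zero hn.ne'
  obtain ⟨d, rfl⟩ := Nat.exists_eq_add_of_lt hnm
  have hv : (FirstOrder.Language.Term.var 0 : LinArith.LA.Term ℕ).realize
      (fun _ => LinArith.Ext.nonstd k) = .nonstd k := rfl
  rw [show n + 1 + d + 1 = (n + d + 1) + 1 by ring, LinArith.realize_ext_mulConst _ hv]
  refine (congrArg₂ LinArith.Ext.add (LinArith.realize_ext_mulConst _ hv n)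
    (LinArith.realize_ext_numeral _ _)).trans ?_
  simp only [LinArith.Ext.add, LinArith.Ext.val]
  rw [show n + d + 1 + 1 - (n + 1) = d + 1 by omega]
  congr 1
  push_cast
  ring
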